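/- Let $\mathbb{N}=\{0,1,2,\dots\}$. For a polynomial $p$ over $\mathbb{C}$ let $P$ be the unique polynomial with $\sum_{\nu=1}^n p(\nu)=P(n)$ for all $n\in\mathbb{N}$, and for $a,b\in\mathbb{C}$ put $\overset{\leftrightarrow}{\sum}{}_{\nu=a}^{b}\,p(\nu):=P(b)-P(a-1)$. Let $U\subset\mathbb{C}$ satisfy $U+1\subset U$. A function $f\colon U\to\mathbb{C}$ is an *approximate polynomial* of degree $\sigma\in\mathbb{N}\cup\{-\infty\}$ if there are polynomials $p_n$ $(n\in\mathbb{N})$, all of degree $\sigma$, with $|f(n+x)-p_n(n+x)|\to0$ as $n\to\infty$ for every $x\in U$. It is *right summable* if, in addition, for all $a,b$ with $a\in U$ and $b+1\in U$ the limit $$\overset{\to}{\sum_{\nu=a}^{b}}f(\nu):=\lim_{n\to\infty}\Bigl(\;\overset{\leftrightarrow}{\sum}{}_{\nu=n+a}^{n+b}\,p_n(\nu)+\sum_{\nu=1}^{n}\bigl(f(\nu+a-1)-f(\nu+b)\bigr)\Bigr)$$ exists; its value, which does not depend on the choice of the $p_n$, is the *fractional sum* of $f$ from $a$ to $b$. Let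 $U=\mathbb{C}\setminus\{0,-1,-2,\dots\}$, and for $\nu\in U$ and $a\in\mathbb{C}$ let $\nu^a=\exp(a\log\nu)$ with the principal branch of the logarithm, $-\pi<\operatorname{Im}\log\nu\le\pi$. **Lemma (Double Sums of Powers).** For every $a\in\mathbb{C}$ the function $\nu\mapsto\nu^a$ is right summable on $U$, so that $$S_a(x):=\overset{\to}{\sum_{\nu=1}^{x}}\nu^a$$ is defined for all $x\in\mathbb{C}\setminus\{-1,-2,-3,\dots\}$. For all $a,b\in\mathbb{C}$ the function $\nu\mapsto S_a(\nu)\,\nu^b+S_b(\nu)\,\nu^a$ is right summable on $U$, and for every $x\in\mathbb{C}\setminus\{-1,-2,-3,\dots\}$ $$\overset{\to}{\sum_{\nu=1}^{x}}\bigl(S_a(\nu)\,\nu^b+S_b(\nu)\,\nu^a\bigr)=S_a(x)\,S_b(x)+S_{a+b}(x).$$ **Corollary (Double Power Sum).** For every $a\in\mathbb{C}$ the function $\nu\mapsto S_a(\nu)$ is right summable on $U$, and for every $x\in\mathbb{C}\setminus\{-1,-2,-3,\dots\}$ $$\overset{\to}{\sum_{\nu=1}^{x}}S_a(\nu)=S_a(x)\,(x+1)-S_{a+1}(x).$$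 -/

import Mathlib

open Filter Topology

namespace FracSum

open Polynomial in
/-- Faulhaber: the sums `∑_{ν=1}^n p(ν)` of a polynomial are themselves given by a polynomial,
whose degree is at most one larger. -/
theorem exists_sumPoly_natDegree_le (N : ℕ) (p : ℂ[X]) (hp : p.natDegree ≤ N) :
    ∃ P : ℂ[X], P.natDegree ≤ N + 1 ∧
      ∀ n : ℕ, ∑ ν ∈ Finset.Icc 1 n, p.eval (ν : ℂ) = P.eval (n : ℂ) := by
  have key : ∀ k : ℕ, ∃ F : ℂ[X], F.natDegree ≤ k + 1 ∧
      ∀ n : ℕ, ∑ ν ∈ Finset.Icc 1 n, (ν : ℂ) ^ k = F.eval (n : ℂ) := by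
    intro k
    refine ⟨C ((k : ℂ) + 1)⁻¹ * (((Polynomial.bernoulli (k + 1)).map (algebraMap ℚ ℂ)).comp (X + C 1) -
      C (algebraMap ℚ ℂ (_root_.bernoulli (k + 1)))) - C ((0 : ℂ) ^ k), ?_, ?_⟩
    · have hB : (Polynomial.bernoulli (k + 1)).natDegree ≤ k + 1 := by
        rw [Polynomial.bernoulli_def]
        refine natDegree_sum_le_of_forall_le _ _ fun i hi => ?_
        refine (natDegree_monomial_le _).trans ?_
        have := Finset.mem_range.1 hi
        omega
      have hB' : (((Polynomial.bernoulli (k + 1)).map (algebraMap ℚ ℂ)).comp (X + C 1)).natDegree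
          ≤ k + 1 := by
        rw [natDegree_comp, natDegree_X_add_C, mul_one]
        exact natDegree_map_le.trans hB
      refine natDegree_sub_C.le.trans ?_
      refine (natDegree_C_mul_le _ _).trans ?_
      exact natDegree_sub_C.le.trans hB'
    · intro n
      have h := sum_range_pow_eq_bernoulli_sub (n + 1) k
      have h2 := congrArg (algebraMap ℚ ℂ) h
      have hk : ((k : ℂ) + 1) ≠ 0 := Nat.cast_add_one_ne_zero k
      have h3 : (eval ((n : ℂ) + 1) ((Polynomial.bernoulli (k + 1)).map (algebraMap ℚ ℂ))) =
          algebraMap ℚ ℂ ((Polynomial.bernoulli (k + 1)).eval ((n + 1 : ℕ) : ℚ)) := by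
        rw [← eval_map_apply]
        simp
      have h4 : ∑ ν ∈ Finset.range (n + 1), (ν : ℂ) ^ k =
          (0 : ℂ) ^ k + ∑ ν ∈ Finset.Icc 1 n, (ν : ℂ) ^ k := by
        rw [Finset.range_eq_Ico, Finset.sum_eq_sum_Ico_succ_bot (Nat.succ_pos n)]
        simp only [Nat.cast_zero]
        rfl
      simp only [map_mul, map_add, map_one, map_natCast, map_sum, map_pow, map_sub] at h2
      rw [h4] at h2
      simp only [eval_sub, eval_mul, eval_C, eval_comp, eval_add, eval_X]
      rw [h3]
      rw [← h2]
      field_simp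
      ring
  choose F hF hF2 using key
  refine ⟨∑ k ∈ Finset.range (N + 1), C (p.coeff k) * F k, ?_, fun n => ?_⟩
  · refine natDegree_sum_le_of_forall_le _ _ fun k hk => ?_
    refine (natDegree_C_mul_le _ _).trans ((hF k).trans ?_)
    have := Finset.mem_range.1 hk
    omega
  · simp only [eval_finsetSum, eval_mul, eval_C, ← hF2, Finset.mul_sum]
    rw [Finset.sum_comm]
    exact Finset.sum_congr rfl fun ν _ => eval_eq_sum_range' (Nat.lt_succ_of_le hp) _

/-- The polynomial `P` with `∑_{ν=1}^n p(ν) = P(n)` for all `n ∈ ℕ` exists and is unique. -/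
theorem existsUnique_sumPoly (p : Polynomial ℂ) :
    ∃! P : Polynomial ℂ,
      ∀ n : ℕ, ∑ ν ∈ Finset.Icc 1 n, p.eval (ν : ℂ) = P.eval (n : ℂ) := by
  obtain ⟨P, -, hP⟩ := exists_sumPoly_natDegree_le _ p le_rfl
  refine ⟨P, hP, fun Q hQ => ?_⟩
  refine Polynomial.eq_of_infinite_eval_eq _ _ ?_
  refine (Set.infinite_range_of_injective (Nat.cast_injective (R := ℂ))).mono ?_
  rintro _ ⟨n, rfl⟩
  exact (hQ n).symm.trans (hP n)

/-- The unique polynomial `P` with `∑_{ν=1}^n p(ν) = P(n)` for all `n ∈ ℕ`. -/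
noncomputable def sumPoly (p : Polynomial ℂ) : Polynomial ℂ :=
  (existsUnique_sumPoly p).choose

theorem sumPoly_spec (p : Polynomial ℂ) (n : ℕ) :
    ∑ ν ∈ Finset.Icc 1 n, p.eval (ν : ℂ) = (sumPoly p).eval (n : ℂ) :=
  (existsUnique_sumPoly p).choose_spec.1 n

/-- The fractional sum `∑_{ν=a}^b p(ν) = P(b) - P(a-1)` of a polynomial, for `a b : ℂ`. -/
noncomputable def polySum (p : Polynomial ℂ) (a b : ℂ) : ℂ :=
  (sumPoly p).eval b - (sumPoly p).eval (a - 1)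

/-- `f : U → ℂ` is a (right) approximate polynomial of degree `σ ∈ ℕ ∪ {-∞}` and `(p_n)` is a
sequence of approximating polynomials of fixed degree `σ`. The values of `f` outside `U` are
irrelevant. -/
structure IsApproxBy (U : Set ℂ) (f : ℂ → ℂ) (σ : WithBot ℕ) (p : ℕ → Polynomial ℂ) :
    Prop where
  add_one_mem : ∀ u ∈ U, u + 1 ∈ U
  degree_eq : ∀ n, (p n).degree = σ
  tendsto : ∀ x ∈ U,
    Tendsto (fun n : ℕ => ‖f ((n : ℂ) + x) - (p n).eval ((n : ℂ) + x)‖) atTop (𝓝 0)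

/-- The `n`-th term of the sequence whose limit is the fractional sum of `f` from `a` to `b`. -/
noncomputable def rightTerm (f : ℂ → ℂ) (p : ℕ → Polynomial ℂ) (a b : ℂ) (n : ℕ) : ℂ :=
  polySum (p n) ((n : ℂ) + a) ((n : ℂ) + b) +
    ∑ ν ∈ Finset.Icc 1 n, (f ((ν : ℂ) + a - 1) - f ((ν : ℂ) + b))

/-- `f : U → ℂ` is right summable and `(p_n)` is a sequence of approximating polynomials (of fixed
degree `σ`) for it. -/
def IsRightSummableBy (U : Set ℂ) (f : ℂ → ℂ) (σ : WithBot ℕ) (p : ℕ → Polynomial ℂ) : Prop :=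
  IsApproxBy U f σ p ∧
    ∀ a b : ℂ, a ∈ U → b + 1 ∈ U → ∃ s : ℂ, Tendsto (rightTerm f p a b) atTop (𝓝 s)

/-- `f : U → ℂ` is right summable. -/
def IsRightSummable (U : Set ℂ) (f : ℂ → ℂ) : Prop :=
  ∃ (σ : WithBot ℕ) (p : ℕ → Polynomial ℂ), IsRightSummableBy U f σ p

/-- `f : U → ℂ` is right summable, `a, b + 1 ∈ U`, and `s` is the fractional sum of `f` from `a`
to `b`. -/
def HasRightSum (U : Set ℂ) (f : ℂ → ℂ) (a b s : ℂ) : Prop :=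
  a ∈ U ∧ b + 1 ∈ U ∧
    ∃ (σ : WithBot ℕ) (p : ℕ → Polynomial ℂ),
      IsRightSummableBy U f σ p ∧ Tendsto (rightTerm f p a b) atTop (𝓝 s)

theorem sumPoly_natDegree_le {N : ℕ} {p : Polynomial ℂ} (hp : p.natDegree ≤ N) :
    (sumPoly p).natDegree ≤ N + 1 := by
  obtain ⟨P, hP, h⟩ := exists_sumPoly_natDegree_le N p hp
  rwa [(existsUnique_sumPoly p).unique (sumPoly_spec p) h]

theorem sumPoly_add_one (p : Polynomial ℂ) (z : ℂ) :
    (sumPoly p).eval (z + 1) = (sumPoly p).eval z + p.eval (z + 1) := by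
  have h : (sumPoly p).comp (Polynomial.X + 1) = sumPoly p + p.comp (Polynomial.X + 1) := by
    refine Polynomial.eq_of_infinite_eval_eq _ _ ?_
    refine (Set.infinite_range_of_injective (Nat.cast_injective (R := ℂ))).mono ?_
    rintro _ ⟨n, rfl⟩
    have := sumPoly_spec p (n + 1)
    rw [Finset.sum_Icc_succ_top (by omega), sumPoly_spec] at this
    simpa using this.symm
  simpa using congrArg (Polynomial.eval z) h

theorem sumPoly_sub (p q : Polynomial ℂ) : sumPoly (p - q) = sumPoly p - sumPoly q := by
  refine (existsUnique_sumPoly (p - q)).unique (sumPoly_spec _) fun n => ?_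
  simp [← sumPoly_spec]

theorem sumPoly_add_nat (p : Polynomial ℂ) (z : ℂ) (k : ℕ) :
    (sumPoly p).eval (z + k) = (sumPoly p).eval z + ∑ j ∈ Finset.range k, p.eval (z + j + 1) := by
  induction k with
  | zero => simp
  | succ k ih =>
    rw [Finset.sum_range_succ, ← add_assoc, ← ih, ← sumPoly_add_one]
    push_cast
    ring_nf

/-- The value of a fractional sum does not depend on the approximating polynomials. -/
theorem HasRightSum.unique {U : Set ℂ} {f : ℂ → ℂ} {a b s t : ℂ}
    (hs : HasRightSum U f a b s) (ht : HasRightSum U f a b t) : s = t := by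
  obtain ⟨ha, -, σ, p, ⟨hp, -⟩, hs⟩ := hs
  obtain ⟨-, -, τ, q, ⟨hq, -⟩, ht⟩ := ht
  set N := max (p 0).natDegree (q 0).natDegree with hN
  have hd : ∀ n, (p n - q n).natDegree ≤ N := by
    intro n
    refine (Polynomial.natDegree_sub_le _ _).trans ?_
    rw [hN, Polynomial.natDegree_eq_of_degree_eq ((hp.degree_eq n).trans (hp.degree_eq 0).symm),
      Polynomial.natDegree_eq_of_degree_eq ((hq.degree_eq n).trans (hq.degree_eq 0).symm)]
  have hU : ∀ k : ℕ, a + k ∈ U := by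
    intro k
    induction k with
    | zero => simpa using ha
    | succ k ih =>
      have := hp.add_one_mem _ ih
      push_cast
      rwa [← add_assoc]
  have hd0 : ∀ k : ℕ, Tendsto (fun n : ℕ => (p n - q n).eval ((n : ℂ) + (a + k))) atTop (𝓝 0) := by
    intro k
    have h1 := tendsto_zero_iff_norm_tendsto_zero.2 (hp.tendsto _ (hU k))
    have h2 := tendsto_zero_iff_norm_tendsto_zero.2 (hq.tendsto _ (hU k))
    have := h2.sub h1
    simpa using this
  -- the shifted sum polynomials
  let Q : ℕ → Polynomial ℂ := fun n =>
    (sumPoly (p n - q n)).comp (Polynomial.X + Polynomial.C ((n : ℂ) + (a - 1))) -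
      Polynomial.C ((sumPoly (p n - q n)).eval ((n : ℂ) + (a - 1)))
  have hQdeg : ∀ n, (Q n).natDegree ≤ N + 1 := by
    intro n
    refine Polynomial.natDegree_sub_C.le.trans ?_
    rw [Polynomial.natDegree_comp, Polynomial.natDegree_X_add_C, mul_one]
    exact sumPoly_natDegree_le (hd n)
  have hQ : ∀ k : ℕ, Tendsto (fun n => (Q n).eval (k : ℂ)) atTop (𝓝 0) := by
    intro k
    have h1 : ∀ n, (Q n).eval (k : ℂ) =
        ∑ j ∈ Finset.range k, (p n - q n).eval ((n : ℂ) + (a + j)) := by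
      intro n
      simp only [Q, Polynomial.eval_sub, Polynomial.eval_comp, Polynomial.eval_add,
        Polynomial.eval_X, Polynomial.eval_C]
      rw [add_comm (k : ℂ), sumPoly_add_nat, add_sub_cancel_left]
      refine Finset.sum_congr rfl fun j _ => ?_
      rw [← Polynomial.eval_sub]
      ring_nf
    simp only [h1]
    simpa using tendsto_finsetSum (Finset.range k) fun j _ => hd0 j
  have hQz : ∀ z : ℂ, Tendsto (fun n => (Q n).eval z) atTop (𝓝 0) := by
    intro z
    have h1 : ∀ n, (Q n).eval z = ∑ k ∈ Finset.range (N + 2),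
        (Q n).eval (k : ℂ) * (Lagrange.basis (Finset.range (N + 2)) (fun k : ℕ => (k : ℂ)) k).eval z := by
      intro n
      have h2 := Lagrange.eq_interpolate (s := Finset.range (N + 2)) (v := fun k : ℕ => (k : ℂ))
        (f := Q n) (Nat.cast_injective.injOn) (by
          rw [Finset.card_range]
          exact Polynomial.degree_le_natDegree.trans_lt (by
            have := hQdeg n
            exact_mod_cast Nat.lt_succ_of_le this))
      conv_lhs => rw [h2]
      simp [Lagrange.interpolate_apply, Polynomial.eval_finsetSum]
    simp only [h1]
    simpa using tendsto_finsetSum (Finset.range (N + 2)) fun k _ =>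
      (hQ k).mul_const ((Lagrange.basis (Finset.range (N + 2)) (fun k : ℕ => (k : ℂ)) k).eval z)
  have hlim := hs.sub ht
  have hEq : (fun n => rightTerm f p a b n - rightTerm f q a b n) =
      fun n => (Q n).eval (b - (a - 1)) := by
    funext n
    simp only [rightTerm, polySum, Q, sumPoly_sub, Polynomial.eval_sub, Polynomial.eval_comp,
      Polynomial.eval_add, Polynomial.eval_X, Polynomial.eval_C]
    ring_nf
  rw [hEq] at hlim
  exact sub_eq_zero.1 (tendsto_nhds_unique hlim (hQz _))

open Classical in
/-- The fractional sum of `f : U → ℂ` from `a` to `b`; it is given the value `0` where it does not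
exist. -/
noncomputable def rightSum (U : Set ℂ) (f : ℂ → ℂ) (a b : ℂ) : ℂ :=
  if h : ∃ s, HasRightSum U f a b s then h.choose else 0

/-- The domain `ℂ ∖ {0, -1, -2, …}`, on which all complex powers `ν ↦ ν ^ a` are defined. -/
def powDomain : Set ℂ := {z | ∀ k : ℕ, z ≠ -(k : ℂ)}

/-- The fractional power sum `S_a(x) = ∑_{ν=1}^x ν ^ a`. -/
noncomputable def powSum (a x : ℂ) : ℂ :=
  rightSum powDomain (fun ν => ν ^ a) 1 x

end FracSum

/-! Everything rests on one principle (`telescope`): if `g` is approximated near `n` by polynomials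
of bounded degree and `f x = g x - g (x - 1)`, then `f` is right summable and its fractional sums
are differences of values of `g`. Both formulas then become discrete product rules. With `A`, `B`
the antidifferences of `x ^ a`, `x ^ b`, the function `A B` has backward difference `A x ^ b + B x ^
a - x ^ (a + b)`, and adding the antidifference of `x ^ (a + b)` cancels the last term.

It remains to show that `S_a`, `S_b` and their products are approximable. Since the growth of one
factor magnifies the error of the other, convergence to `0` is not enough, and errors `O(n ^ (-M))`
are required for every `M`, together with polynomial growth: this is `Tame`. Tame functions are
closed under sums and products. Powers are tame by Taylor expansion of `(1 + x / n) ^ a`. An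
antidifference of a tame function is constructed as the limit defining its fractional sum, and is
again tame. -/

namespace FracSum

open Asymptotics

/-! ### Polynomials of bounded degree, telescoping of fractional sums. -/

section Polynomials

open Polynomial

/-- Lagrange interpolation at the nodes `c n + 0, …, c n + N` expresses every other value with
coefficients that do not depend on `n`. -/
theorem eval_isBigO_of_nat {N : ℕ} {Q : ℕ → ℂ[X]} {c : ℕ → ℂ} {φ : ℕ → ℝ}
    (hQ : ∀ n, (Q n).natDegree ≤ N)
    (h : ∀ k : ℕ, (fun n => (Q n).eval (c n + k)) =O[atTop] φ) (z : ℂ) :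
    (fun n => (Q n).eval (c n + z)) =O[atTop] φ := by
  have h1 : ∀ n, (Q n).eval (c n + z) = ∑ k ∈ Finset.range (N + 1),
      (Q n).eval (c n + k) *
        (Lagrange.basis (Finset.range (N + 1)) (fun k : ℕ => (k : ℂ)) k).eval z := by
    intro n
    have hd : ((Q n).comp (X + C (c n))).natDegree ≤ N := by
      rw [natDegree_comp, natDegree_X_add_C, mul_one]
      exact hQ n
    have h2 := Lagrange.eq_interpolate (s := Finset.range (N + 1)) (v := fun k : ℕ => (k : ℂ))
      (f := (Q n).comp (X + C (c n))) Nat.cast_injective.injOn (by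
        rw [Finset.card_range]
        exact degree_le_natDegree.trans_lt (by exact_mod_cast Nat.lt_succ_of_le hd))
    have h3 := congrArg (eval z) h2
    simpa [Lagrange.interpolate_apply, eval_finsetSum, add_comm] using h3
  simp only [h1]
  refine IsBigO.fun_sum fun k _ => ?_
  simpa only [mul_comm] using
    (h k).const_mul_left ((Lagrange.basis (Finset.range (N + 1)) (fun k : ℕ => (k : ℂ)) k).eval z)

theorem polySum_isBigO {N : ℕ} {Q : ℕ → ℂ[X]} {c : ℕ → ℂ} {φ : ℕ → ℝ}
    (hQ : ∀ n, (Q n).natDegree ≤ N)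
    (h : ∀ k : ℕ, (fun n => (Q n).eval (c n + k)) =O[atTop] φ) (a b : ℂ) :
    (fun n => polySum (Q n) (c n + a) (c n + b)) =O[atTop] φ := by
  have hQ1 := eval_isBigO_of_nat hQ h
  -- Normalised to vanish at `c n`, so that its values at `c n + k` are sums of `k` values of `Q n`;
  -- the subtracted constant drops out of `polySum`.
  let R : ℕ → ℂ[X] := fun n => sumPoly (Q n) - C ((sumPoly (Q n)).eval (c n))
  have hR : ∀ z : ℂ, (fun n => (R n).eval (c n + z)) =O[atTop] φ := by
    refine eval_isBigO_of_nat (N := N + 1) (fun n => ?_) fun k => ?_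
    · exact natDegree_sub_C.le.trans (sumPoly_natDegree_le (hQ n))
    · have : ∀ n, (R n).eval (c n + k) = ∑ j ∈ Finset.range k, (Q n).eval (c n + (j + 1)) := by
        intro n
        simp only [R, eval_sub, eval_C]
        rw [sumPoly_add_nat, add_sub_cancel_left]
        simp only [add_assoc]
      simp only [this]
      exact IsBigO.fun_sum fun j _ => hQ1 (j + 1)
  refine ((hR b).sub (hR (a - 1))).congr_left fun n => ?_
  simp only [R, polySum, eval_sub, eval_C]
  ring_nf

theorem sumPoly_add_C_mul (p q : ℂ[X]) (c : ℂ) :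
    sumPoly (p + C c * q) = sumPoly p + C c * sumPoly q := by
  refine (existsUnique_sumPoly _).unique (sumPoly_spec _) fun n => ?_
  simp [← sumPoly_spec, Finset.sum_add_distrib, Finset.mul_sum]

theorem tendsto_geometric_mul_eval_natCast (q : ℂ[X]) :
    Tendsto (fun n : ℕ => (2⁻¹ : ℂ) ^ n * q.eval (n : ℂ)) atTop (𝓝 0) := by
  induction q using Polynomial.induction_on' with
  | add p q hp hq => simpa only [eval_add, mul_add, add_zero] using hp.add hq
  | monomial k c =>
    have h := tendsto_pow_const_mul_const_pow_of_abs_lt_one k (r := (2⁻¹ : ℝ))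
      (by rw [abs_of_pos] <;> norm_num)
    have h2 := (tendsto_zero_iff_norm_tendsto_zero (f := fun n : ℕ =>
      (n : ℂ) ^ k * (2⁻¹ : ℂ) ^ n)).2 (h.congr fun n => by
        rw [norm_mul, norm_pow, norm_pow, norm_inv, Complex.norm_natCast, Complex.norm_two])
    have h3 := h2.const_mul c
    rw [mul_zero] at h3
    refine h3.congr fun n => ?_
    rw [eval_monomial]
    ring

theorem tendsto_geometric_mul_eval (q : ℂ[X]) (z : ℂ) :
    Tendsto (fun n : ℕ => (2⁻¹ : ℂ) ^ n * q.eval ((n : ℂ) + z)) atTop (𝓝 0) := by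
  refine (tendsto_geometric_mul_eval_natCast (q.comp (X + C z))).congr fun n => ?_
  rw [eval_comp, eval_add, eval_X, eval_C]

/-- Polynomials of bounded degree may be corrected to have a fixed degree without changing
the fractional sum. -/
theorem exists_isRightSummableBy {U : Set ℂ} (hU : ∀ u ∈ U, u + 1 ∈ U) {f : ℂ → ℂ} {N : ℕ}
    {p : ℕ → ℂ[X]} (hp : ∀ n, (p n).natDegree ≤ N)
    (hf : ∀ x ∈ U,
      Tendsto (fun n : ℕ => f ((n : ℂ) + x) - (p n).eval ((n : ℂ) + x)) atTop (𝓝 0))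
    {s : ℂ → ℂ → ℂ}
    (hs : ∀ a b, a ∈ U → b + 1 ∈ U → Tendsto (rightTerm f p a b) atTop (𝓝 (s a b))) :
    ∃ (σ : WithBot ℕ) (q : ℕ → ℂ[X]), IsRightSummableBy U f σ q ∧
      ∀ a b, a ∈ U → b + 1 ∈ U → Tendsto (rightTerm f q a b) atTop (𝓝 (s a b)) := by
  -- The leading coefficient `2⁻ⁿ` is nonzero, which forces degree `N + 1`, yet it beats all
  -- polynomial growth in `n`, so every limit is unchanged.
  let q : ℕ → ℂ[X] := fun n => p n + C ((2⁻¹ : ℂ) ^ n) * X ^ (N + 1)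
  have hq : ∀ a b, a ∈ U → b + 1 ∈ U → Tendsto (rightTerm f q a b) atTop (𝓝 (s a b)) := by
    intro a b ha hb
    have h := (hs a b ha hb).add ((tendsto_geometric_mul_eval (sumPoly (X ^ (N + 1))) b).sub
      (tendsto_geometric_mul_eval (sumPoly (X ^ (N + 1))) (a - 1)))
    simp only [sub_zero, add_zero] at h
    refine h.congr fun n => ?_
    simp only [rightTerm, polySum, q, sumPoly_add_C_mul, eval_add, eval_mul, eval_C]
    ring_nf
  refine ⟨((N + 1 : ℕ) : WithBot ℕ), q, ⟨⟨hU, fun n => ?_, fun x hx => ?_⟩, fun a b ha hb =>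
    ⟨_, hq a b ha hb⟩⟩, hq⟩
  · have hc : ((2⁻¹ : ℂ) ^ n) ≠ 0 := pow_ne_zero _ (inv_ne_zero two_ne_zero)
    have h1 : (C ((2⁻¹ : ℂ) ^ n) * X ^ (N + 1)).degree = ((N + 1 : ℕ) : WithBot ℕ) :=
      degree_C_mul_X_pow _ hc
    rw [degree_add_eq_right_of_degree_lt, h1]
    rw [h1]
    exact degree_le_natDegree.trans_lt (by exact_mod_cast Nat.lt_succ_of_le (hp n))
  · rw [← tendsto_zero_iff_norm_tendsto_zero]
    have h := (hf x hx).sub (tendsto_geometric_mul_eval (X ^ (N + 1)) x)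
    rw [sub_zero] at h
    refine h.congr fun n => ?_
    simp only [q, eval_add, eval_mul, eval_C]
    ring

/-- Fractional sums telescope: if `g` is approximated by polynomials of bounded degree and
`f` is its backward difference, then `f` is right summable with sum `g b - g (a - 1)`. -/
theorem telescope {U : Set ℂ} (hU : ∀ u ∈ U, u + 1 ∈ U) {f g : ℂ → ℂ} {N : ℕ}
    {q : ℕ → ℂ[X]} (hq : ∀ n, (q n).natDegree ≤ N)
    (hg : ∀ x, x + 1 ∈ U →
      Tendsto (fun n : ℕ => g ((n : ℂ) + x) - (q n).eval ((n : ℂ) + x)) atTop (𝓝 0))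
    (hfg : ∀ x ∈ U, g x - g (x - 1) = f x) :
    IsRightSummable U f ∧
      ∀ a b, a ∈ U → b + 1 ∈ U → HasRightSum U f a b (g b - g (a - 1)) := by
  let p : ℕ → ℂ[X] := fun n => q n - (q n).comp (X - C 1)
  have hpdeg : ∀ n, (p n).natDegree ≤ N := fun n => by
    refine (natDegree_sub_le _ _).trans (max_le (hq n) ?_)
    rw [natDegree_comp, natDegree_X_sub_C, mul_one]
    exact hq n
  have hUn : ∀ u ∈ U, ∀ n : ℕ, (n : ℂ) + u ∈ U := by
    intro u hu n
    induction n with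
    | zero => simpa using hu
    | succ n ih =>
      have := hU _ ih
      rwa [show ((n + 1 : ℕ) : ℂ) + u = n + u + 1 by push_cast; ring]
  have hsum : ∀ n, sumPoly (p n) = q n - C ((q n).eval 0) := by
    intro n
    refine (existsUnique_sumPoly _).unique (sumPoly_spec _) fun m => ?_
    induction m with
    | zero => simp
    | succ m ih =>
      rw [Finset.sum_Icc_succ_top (by omega), ih]
      simp [p]
  have hpf : ∀ x ∈ U,
      Tendsto (fun n : ℕ => f ((n : ℂ) + x) - (p n).eval ((n : ℂ) + x)) atTop (𝓝 0) := by
    intro x hx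
    have h := (hg x (hU x hx)).sub (hg (x - 1) (by simpa using hx))
    rw [sub_zero] at h
    refine h.congr fun n => ?_
    rw [← hfg _ (hUn x hx n)]
    simp only [p, eval_sub, eval_comp, eval_X, eval_C]
    ring_nf
  have hlim : ∀ a b, a ∈ U → b + 1 ∈ U →
      Tendsto (rightTerm f p a b) atTop (𝓝 (g b - g (a - 1))) := by
    intro a b ha hb
    have h := ((hg (a - 1) (by simpa using ha)).sub (hg b hb)).add_const (g b - g (a - 1))
    simp only [sub_zero, zero_add] at h
    refine h.congr fun n => ?_
    have hs : ∀ n : ℕ, ∑ ν ∈ Finset.Icc 1 n, (f ((ν : ℂ) + a - 1) - f ((ν : ℂ) + b)) =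
        (g ((n : ℂ) + (a - 1)) - g (a - 1)) - (g ((n : ℂ) + b) - g b) := by
      intro n
      induction n with
      | zero => simp
      | succ n ih =>
        rw [Finset.sum_Icc_succ_top (by omega), ih]
        have h1 := hfg _ (hUn a ha n)
        have h2 := hfg _ (hUn (b + 1) hb n)
        rw [show ((n + 1 : ℕ) : ℂ) + a - 1 = n + a by push_cast; ring,
          show ((n + 1 : ℕ) : ℂ) + b = n + (b + 1) by push_cast; ring, ← h1, ← h2]
        push_cast
        ring_nf
    rw [rightTerm, hs, polySum, hsum]
    simp only [eval_sub, eval_C]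
    ring_nf
  -- The differences `p n` have bounded but possibly varying degree, whereas the definition demands
  -- a fixed one.
  obtain ⟨σ, r, hr, hr'⟩ :=
    exists_isRightSummableBy hU hpdeg hpf (s := fun a b => g b - g (a - 1)) hlim
  exact ⟨⟨σ, r, hr⟩, fun a b ha hb => ⟨ha, hb, σ, r, hr, hr' a b ha hb⟩⟩

/-- Each increment consists only of approximation errors at the two endpoints and of the change from
`p n` to `p (n + 1)`, which is small because both approximate `f` near `n + 1`. -/
theorem rightTerm_succ (f : ℂ → ℂ) (p : ℕ → ℂ[X]) (a b : ℂ) (n : ℕ) :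
    rightTerm f p a b (n + 1) - rightTerm f p a b n =
      polySum (p (n + 1) - p n) (((n + 1 : ℕ) : ℂ) + a) (((n + 1 : ℕ) : ℂ) + b) +
        ((f ((n : ℂ) + a) - (p n).eval ((n : ℂ) + a)) -
          (f ((n : ℂ) + (b + 1)) - (p n).eval ((n : ℂ) + (b + 1)))) := by
  have h1 := sumPoly_add_one (p n) ((n : ℂ) + (a - 1))
  have h2 := sumPoly_add_one (p n) ((n : ℂ) + b)
  simp only [rightTerm, polySum, sumPoly_sub, eval_sub]
  rw [Finset.sum_Icc_succ_top (by omega)]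
  push_cast
  rw [show (n : ℂ) + 1 + a - 1 = n + (a - 1) + 1 by ring,
    show (n : ℂ) + 1 + b = n + b + 1 by ring, h1, h2]
  ring_nf

end Polynomials

/-! ### Decay and growth of sequences from their increments. -/

section Sequences

theorem inv_pow_isBigO {k m : ℕ} (h : m ≤ k) :
    (fun n : ℕ => ((n : ℝ) ^ k)⁻¹) =O[atTop] fun n : ℕ => ((n : ℝ) ^ m)⁻¹ := by
  refine IsBigO.of_bound 1 ?_
  filter_upwards [eventually_ge_atTop 1] with n hn
  have hn' : (1 : ℝ) ≤ n := by exact_mod_cast hn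
  rw [one_mul, Real.norm_of_nonneg (by positivity), Real.norm_of_nonneg (by positivity)]
  gcongr

theorem pow_isBigO {k m : ℕ} (h : k ≤ m) :
    (fun n : ℕ => (n : ℝ) ^ k) =O[atTop] fun n : ℕ => (n : ℝ) ^ m := by
  refine IsBigO.of_bound 1 ?_
  filter_upwards [eventually_ge_atTop 1] with n hn
  have hn' : (1 : ℝ) ≤ n := by exact_mod_cast hn
  rw [one_mul, Real.norm_of_nonneg (by positivity), Real.norm_of_nonneg (by positivity)]
  gcongr

theorem inv_pow_succ_isBigO (k : ℕ) :
    (fun n : ℕ => (((n + 1 : ℕ) : ℝ) ^ k)⁻¹) =O[atTop] fun n : ℕ => ((n : ℝ) ^ k)⁻¹ := by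
  refine IsBigO.of_bound 1 ?_
  filter_upwards [eventually_ge_atTop 1] with n hn
  have hn' : (0 : ℝ) < n := by exact_mod_cast hn
  rw [one_mul, Real.norm_of_nonneg (by positivity), Real.norm_of_nonneg (by positivity)]
  gcongr
  simp

theorem tendsto_inv_pow_succ (k : ℕ) :
    Tendsto (fun n : ℕ => ((n : ℝ) ^ (k + 1))⁻¹) atTop (𝓝 0) :=
  tendsto_inv_atTop_zero.comp
    ((tendsto_pow_atTop k.succ_ne_zero).comp tendsto_natCast_atTop_atTop)

/-- A sequence whose increments decay like `n ^ (-(M + 2))` converges, with error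
`O(n ^ (-M))`. -/
theorem exists_tendsto_of_diff_isBigO {u : ℕ → ℂ} {M : ℕ}
    (h : (fun n => u (n + 1) - u n) =O[atTop] fun n : ℕ => ((n : ℝ) ^ (M + 2))⁻¹) :
    ∃ s : ℂ, Tendsto u atTop (𝓝 s) ∧
      (fun n => s - u n) =O[atTop] fun n : ℕ => ((n : ℝ) ^ M)⁻¹ := by
  set d : ℕ → ℂ := fun n => u (n + 1) - u n with hd
  have hsummable : Summable d :=
    summable_of_isBigO_nat (Real.summable_nat_pow_inv.2 (by omega : 1 < M + 2)) h
  have hpart : ∀ n, ∑ i ∈ Finset.range n, d i = u n - u 0 := fun n => Finset.sum_range_sub u n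
  have hu : ∀ n, u n = u 0 + ∑ i ∈ Finset.range n, d i := fun n => by rw [hpart]; ring
  refine ⟨u 0 + ∑' i, d i, ?_, ?_⟩
  · refine (hsummable.hasSum.tendsto_sum_nat.const_add (u 0)).congr fun n => (hu n).symm
  · obtain ⟨C, hC0, hC⟩ := h.exists_pos
    obtain ⟨n₀, hn₀⟩ := eventually_atTop.1 hC.bound
    have hz : Summable fun i : ℕ => (((i + 1 : ℕ) : ℝ) ^ 2)⁻¹ :=
      (summable_nat_add_iff 1).2 (Real.summable_nat_pow_inv.2 (by norm_num : 1 < 2))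
    refine IsBigO.of_bound (C * ∑' i : ℕ, (((i + 1 : ℕ) : ℝ) ^ 2)⁻¹) ?_
    filter_upwards [eventually_ge_atTop (max n₀ 1)] with n hn
    have hn1 : 1 ≤ n := (le_max_right _ _).trans hn
    have hn0 : n₀ ≤ n := (le_max_left _ _).trans hn
    have hnpos : (0 : ℝ) < n := by exact_mod_cast hn1
    have htail : u 0 + ∑' i, d i - u n = ∑' i, d (i + n) := by
      rw [← hsummable.sum_add_tsum_nat_add n, hpart]
      ring
    rw [htail, Real.norm_of_nonneg (by positivity)]
    have hsum := (hz.hasSum.mul_left (C * ((n : ℝ) ^ M)⁻¹))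
    refine (tsum_of_norm_bounded hsum fun i => ?_).trans (le_of_eq (by ring))
    -- For `n ≥ 1`, `(i + n) ^ (M + 2) ≥ n ^ M * (i + 1) ^ 2`: two powers pay for summability, the
    -- other `M` give the rate.
    refine (hn₀ (i + n) (by omega)).trans ?_
    rw [Real.norm_of_nonneg (by positivity), mul_assoc, ← mul_inv, pow_add]
    push_cast
    have hn1' : (1 : ℝ) ≤ n := by exact_mod_cast hn1
    have h3 : (n : ℝ) ≤ i + n := by simp
    have h4 : (i : ℝ) + 1 ≤ i + n := by linarith
    gcongr

theorem isBigO_pow_succ_of_diff {u : ℕ → ℂ} {K : ℕ}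
    (h : (fun n => u (n + 1) - u n) =O[atTop] fun n : ℕ => (n : ℝ) ^ K) :
    u =O[atTop] fun n : ℕ => (n : ℝ) ^ (K + 1) := by
  obtain ⟨C, hC0, hC⟩ := h.exists_pos
  obtain ⟨n₀, hn₀⟩ := eventually_atTop.1 hC.bound
  have key : ∀ n, n₀ ≤ n → ‖u n‖ ≤ ‖u n₀‖ + C * (n : ℝ) ^ (K + 1) := by
    intro n hn
    induction n, hn using Nat.le_induction with
    | base => simp only [le_add_iff_nonneg_right]; positivity
    | succ n hn ih =>
      have h1 := hn₀ n hn
      rw [Real.norm_of_nonneg (by positivity)] at h1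
      have h2 : ‖u (n + 1)‖ ≤ ‖u n‖ + ‖u (n + 1) - u n‖ := by
        simpa using norm_add_le (u n) (u (n + 1) - u n)
      have h3 : (n : ℝ) ^ (K + 1) + (n : ℝ) ^ K ≤ ((n + 1 : ℕ) : ℝ) ^ (K + 1) := by
        push_cast
        calc (n : ℝ) ^ (K + 1) + (n : ℝ) ^ K = (n : ℝ) ^ K * (n + 1) := by ring
          _ ≤ ((n : ℝ) + 1) ^ K * (n + 1) := by gcongr; simp
          _ = _ := by ring
      nlinarith
  refine IsBigO.of_bound (‖u n₀‖ + C) ?_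
  filter_upwards [eventually_ge_atTop (max n₀ 1)] with n hn
  have hn1 : (1 : ℝ) ≤ n := by exact_mod_cast (le_max_right _ _).trans hn
  rw [Real.norm_of_nonneg (by positivity)]
  have h1 : (1 : ℝ) ≤ (n : ℝ) ^ (K + 1) := one_le_pow₀ hn1
  have := key n ((le_max_left _ _).trans hn)
  nlinarith [norm_nonneg (u n₀)]

end Sequences

/-! ### The domain, and the algebra of tame functions. -/

theorem powDomain_add_one : ∀ u ∈ powDomain, u + 1 ∈ powDomain := by
  intro u hu k hk
  refine hu (k + 1) ?_
  push_cast
  linear_combination hk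

theorem powDomain_ne_zero {u : ℂ} (hu : u ∈ powDomain) : u ≠ 0 := by
  simpa using hu 0

theorem one_mem_powDomain : (1 : ℂ) ∈ powDomain := by
  intro k hk
  have h : ((k + 1 : ℕ) : ℂ) = 0 := by push_cast; linear_combination hk
  exact k.succ_ne_zero (Nat.cast_eq_zero.1 h)

theorem natCast_add_mem_powDomain {u : ℂ} (hu : u ∈ powDomain) (n : ℕ) :
    (n : ℂ) + u ∈ powDomain := by
  induction n with
  | zero => simpa using hu
  | succ n ih =>
    have := powDomain_add_one _ ih
    rwa [show ((n + 1 : ℕ) : ℂ) + u = n + u + 1 by push_cast; ring]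

/-- `f` is approximated by the polynomials `p n` of bounded degree on translates of
`ℂ ∖ {-1, -2, …}`, with an error of order `n ^ (-M)`. -/
def ApproxOrder (f : ℂ → ℂ) (M : ℕ) (p : ℕ → Polynomial ℂ) : Prop :=
  (∃ N, ∀ n, (p n).natDegree ≤ N) ∧
    ∀ x, x + 1 ∈ powDomain →
      (fun n : ℕ => f ((n : ℂ) + x) - (p n).eval ((n : ℂ) + x)) =O[atTop]
        fun n : ℕ => ((n : ℝ) ^ M)⁻¹

/-- `f` grows at most polynomially and has polynomial approximations of bounded degree of
every order. -/
def Tame (f : ℂ → ℂ) : Prop :=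
  (∃ K : ℕ, ∀ x, x + 1 ∈ powDomain →
      (fun n : ℕ => f ((n : ℂ) + x)) =O[atTop] fun n : ℕ => (n : ℝ) ^ K) ∧
    ∀ M, ∃ p, ApproxOrder f M p

theorem ApproxOrder.tendsto {f : ℂ → ℂ} {M : ℕ} {p : ℕ → Polynomial ℂ}
    (h : ApproxOrder f (M + 1) p) {x : ℂ} (hx : x + 1 ∈ powDomain) :
    Tendsto (fun n : ℕ => f ((n : ℂ) + x) - (p n).eval ((n : ℂ) + x)) atTop (𝓝 0) :=
  (h.2 x hx).trans_tendsto (tendsto_inv_pow_succ M)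

theorem Tame.telescope {f g : ℂ → ℂ} (hg : Tame g)
    (hfg : ∀ x ∈ powDomain, g x - g (x - 1) = f x) :
    IsRightSummable powDomain f ∧
      ∀ a b, a ∈ powDomain → b + 1 ∈ powDomain →
        HasRightSum powDomain f a b (g b - g (a - 1)) := by
  obtain ⟨q, hq⟩ := hg.2 1
  obtain ⟨N, hN⟩ := hq.1
  exact FracSum.telescope powDomain_add_one hN (fun x hx => hq.tendsto hx) hfg

theorem Tame.sub {f g : ℂ → ℂ} (hf : Tame f) (hg : Tame g) : Tame (fun x => f x - g x) := by
  obtain ⟨⟨K, hK⟩, hf⟩ := hf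
  obtain ⟨⟨L, hL⟩, hg⟩ := hg
  refine ⟨⟨max K L, fun x hx => ((hK x hx).trans (pow_isBigO (le_max_left _ _))).sub
    ((hL x hx).trans (pow_isBigO (le_max_right _ _)))⟩, fun M => ?_⟩
  obtain ⟨p, ⟨A, hA⟩, hp⟩ := hf M
  obtain ⟨q, ⟨B, hB⟩, hq⟩ := hg M
  refine ⟨fun n => p n - q n, ⟨max A B, fun n => (Polynomial.natDegree_sub_le _ _).trans
    (max_le_max (hA n) (hB n))⟩, fun x hx => ((hp x hx).sub (hq x hx)).congr_left fun n => ?_⟩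
  rw [Polynomial.eval_sub]
  ring

theorem Tame.add {f g : ℂ → ℂ} (hf : Tame f) (hg : Tame g) : Tame (fun x => f x + g x) := by
  obtain ⟨⟨K, hK⟩, hf⟩ := hf
  obtain ⟨⟨L, hL⟩, hg⟩ := hg
  refine ⟨⟨max K L, fun x hx => ((hK x hx).trans (pow_isBigO (le_max_left _ _))).add
    ((hL x hx).trans (pow_isBigO (le_max_right _ _)))⟩, fun M => ?_⟩
  obtain ⟨p, ⟨A, hA⟩, hp⟩ := hf M
  obtain ⟨q, ⟨B, hB⟩, hq⟩ := hg M
  refine ⟨fun n => p n + q n, ⟨max A B, fun n => (Polynomial.natDegree_add_le _ _).trans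
    (max_le_max (hA n) (hB n))⟩, fun x hx => ((hp x hx).add (hq x hx)).congr_left fun n => ?_⟩
  rw [Polynomial.eval_add]
  ring

theorem pow_mul_inv_pow_isBigO (K M : ℕ) :
    (fun n : ℕ => (n : ℝ) ^ K * ((n : ℝ) ^ (K + M))⁻¹) =O[atTop]
      fun n : ℕ => ((n : ℝ) ^ M)⁻¹ := by
  refine EventuallyEq.isBigO ?_
  filter_upwards [eventually_ge_atTop 1] with n hn
  have hn' : (n : ℝ) ≠ 0 := by exact_mod_cast (by omega : n ≠ 0)
  rw [pow_add]
  field_simp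

/-- Each factor is approximated to an order raised by the growth exponent of the other, using `f g -
p q = f (g - q) + g (f - p) - (f - p) (g - q)`. -/
theorem Tame.mul {f g : ℂ → ℂ} (hf : Tame f) (hg : Tame g) : Tame (fun x => f x * g x) := by
  obtain ⟨⟨K, hK⟩, hf⟩ := hf
  obtain ⟨⟨L, hL⟩, hg⟩ := hg
  refine ⟨⟨K + L, fun x hx => ((hK x hx).mul (hL x hx)).congr_right fun n => (pow_add _ _ _).symm⟩,
    fun M => ?_⟩
  obtain ⟨p, ⟨A, hA⟩, hp⟩ := hf (L + M)
  obtain ⟨q, ⟨B, hB⟩, hq⟩ := hg (K + M)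
  refine ⟨fun n => p n * q n, ⟨A + B, fun n => Polynomial.natDegree_mul_le.trans
    (add_le_add (hA n) (hB n))⟩, fun x hx => ?_⟩
  have h1 := ((hK x hx).mul (hq x hx)).trans (pow_mul_inv_pow_isBigO K M)
  have h2 := ((hL x hx).mul (hp x hx)).trans (pow_mul_inv_pow_isBigO L M)
  have h3 := (((hp x hx).trans (inv_pow_isBigO (Nat.le_add_left M L))).mul
    ((hq x hx).trans (inv_pow_isBigO (Nat.zero_le _)))).congr_right
      (g₂ := fun n : ℕ => ((n : ℝ) ^ M)⁻¹) fun n => by simp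
  refine ((h1.add h2).sub h3).congr_left fun n => ?_
  rw [Polynomial.eval_mul]
  ring

theorem tame_add_one : Tame (fun x => x + 1) := by
  refine ⟨⟨1, fun x _ => ?_⟩, fun M => ⟨fun _ => Polynomial.X + 1, ⟨_, fun _ => le_rfl⟩, fun x _ => ?_⟩⟩
  · refine isBigO_pow_succ_of_diff (K := 0) ?_
    refine (isBigO_const_const (1 : ℂ) (one_ne_zero (α := ℝ)) atTop).congr (fun n => ?_) fun n => ?_
    · push_cast
      ring
    · simp
  · simpa using isBigO_zero _ _

/-! ### Complex powers are tame. -/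

/-- A positive real factor leaves the argument alone, so no branch correction appears in the
logarithm. -/
theorem natCast_add_cpow {a x : ℂ} {n : ℕ} (hn : 0 < n) (hx : 1 + x / n ≠ 0) :
    ((n : ℂ) + x) ^ a = (n : ℂ) ^ a * (1 + x / n) ^ a := by
  have hn' : (n : ℂ) ≠ 0 := Nat.cast_ne_zero.2 hn.ne'
  have hnr : (0 : ℝ) < n := Nat.cast_pos.2 hn
  have h : (n : ℂ) + x = ((n : ℝ) : ℂ) * (1 + x / n) := by
    rw [Complex.ofReal_natCast]
    field_simp
  rw [h, Complex.cpow_def_of_ne_zero (mul_ne_zero (by simpa using hn') hx),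
    Complex.cpow_def_of_ne_zero hn', Complex.cpow_def_of_ne_zero hx,
    Complex.log_ofReal_mul hnr hx, Complex.ofReal_log hnr.le, Complex.ofReal_natCast,
    add_mul, Complex.exp_add]

theorem tame_cpow (a : ℂ) : Tame (fun x => x ^ a) := by
  have hA : (fun n : ℕ => (n : ℂ) ^ a) =O[atTop] fun n : ℕ => (n : ℝ) ^ ⌈a.re⌉₊ := by
    refine IsBigO.of_bound 1 ?_
    filter_upwards [eventually_ge_atTop 1] with n hn
    have hn' : (1 : ℝ) ≤ n := by exact_mod_cast hn
    rw [one_mul, Complex.norm_natCast_cpow_of_pos hn, Real.norm_of_nonneg (by positivity),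
      ← Real.rpow_natCast]
    exact Real.rpow_le_rpow_of_exponent_le hn' (Nat.le_ceil _)
  have hdiv : ∀ x : ℂ, Tendsto (fun n : ℕ => x / n) atTop (𝓝 0) := fun x =>
    tendsto_const_div_atTop_nhds_zero_nat x
  have hF : AnalyticAt ℂ (fun w : ℂ => w ^ a) 1 :=
    analyticAt_id.cpow analyticAt_const (by simp)
  have heq : ∀ x : ℂ, (fun n : ℕ => ((n : ℂ) + x) ^ a) =ᶠ[atTop]
      fun n : ℕ => (n : ℂ) ^ a * (1 + x / n) ^ a := by
    intro x
    have h1 : Tendsto (fun n : ℕ => 1 + x / (n : ℂ)) atTop (𝓝 1) := by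
      simpa using (hdiv x).const_add 1
    filter_upwards [eventually_gt_atTop 0, h1.eventually_ne one_ne_zero] with n hn hx
    exact natCast_add_cpow hn hx
  refine ⟨⟨⌈a.re⌉₊, fun x _ => ?_⟩, fun M => ?_⟩
  · have h1 : Tendsto (fun n : ℕ => (1 + x / (n : ℂ)) ^ a) atTop (𝓝 (1 ^ a)) := by
      refine hF.continuousAt.tendsto.comp ?_
      simpa using (hdiv x).const_add 1
    simpa using (heq x).trans_isBigO (hA.mul (h1.isBigO_one ℝ))
  · obtain ⟨s, hs⟩ := hF
    set L := ⌈a.re⌉₊ + M with hL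
    -- Taylor polynomial of `n ^ a * (1 + w) ^ a` at `w = (X - n) / n`, which becomes `x / n` at `n
    -- + x`. Truncating at `L = ⌈Re a⌉₊ + M` leaves `O(n ^ (-M))` after multiplication by `n ^ a`.
    refine ⟨fun n => ∑ k ∈ Finset.range L,
      Polynomial.C ((n : ℂ) ^ a * s.coeff k * ((n : ℂ)⁻¹) ^ k) *
        (Polynomial.X - Polynomial.C (n : ℂ)) ^ k, ⟨L, fun n => ?_⟩, fun x _ => ?_⟩
    · refine Polynomial.natDegree_sum_le_of_forall_le _ _ fun k hk => ?_
      refine (Polynomial.natDegree_C_mul_le _ _).trans ?_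
      rw [Polynomial.natDegree_pow, Polynomial.natDegree_X_sub_C, mul_one]
      exact (Finset.mem_range.1 hk).le
    · have h1 := (hs.isBigO_sub_partialSum_pow L).comp_tendsto (hdiv x)
      have h2 : (fun n : ℕ => ‖x / (n : ℂ)‖ ^ L) =O[atTop] fun n : ℕ => ((n : ℝ) ^ L)⁻¹ := by
        refine ((isBigO_refl (fun n : ℕ => ((n : ℝ) ^ L)⁻¹) atTop).const_mul_left
          (‖x‖ ^ L)).congr_left fun n => ?_
        rw [norm_div, Complex.norm_natCast, div_pow, div_eq_mul_inv]
      have h3 := (hA.mul (h1.trans h2)).trans (pow_mul_inv_pow_isBigO ⌈a.re⌉₊ M)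
      refine h3.congr' ?_ EventuallyEq.rfl
      filter_upwards [heq x] with n hn
      simp only [hn, Function.comp, mul_sub, FormalMultilinearSeries.partialSum,
        FormalMultilinearSeries.apply_eq_pow_smul_coeff, Polynomial.eval_finsetSum,
        Polynomial.eval_mul, Polynomial.eval_C, Polynomial.eval_pow, Polynomial.eval_sub,
        Polynomial.eval_X, add_sub_cancel_left, Finset.mul_sum, smul_eq_mul, div_pow, inv_pow]
      congr 1
      refine Finset.sum_congr rfl fun k _ => ?_
      ring

/-! ### Antidifferences of tame functions. -/

/-- The fractional sum of a function with an approximation of order `M + 2` exists, and it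
has an approximation of order `M`. -/
theorem ApproxOrder.exists_antidifference {f : ℂ → ℂ} {M : ℕ} {p : ℕ → Polynomial ℂ}
    (hp : ApproxOrder f (M + 2) p) :
    ∃ g : ℂ → ℂ, (∃ q, ApproxOrder g M q) ∧ (∀ x ∈ powDomain, g x - g (x - 1) = f x) ∧
      g 0 = 0 := by
  obtain ⟨N, hN⟩ := hp.1
  have hdom : ∀ x, x + 1 ∈ powDomain → x + 1 + 1 ∈ powDomain :=
    fun x hx => powDomain_add_one _ hx
  have hnat : ∀ k : ℕ, (k : ℂ) + 1 ∈ powDomain := natCast_add_mem_powDomain one_mem_powDomain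
  have hlim : ∀ x, x + 1 ∈ powDomain → ∃ s, Tendsto (rightTerm f p 1 x) atTop (𝓝 s) ∧
      (fun n => s - rightTerm f p 1 x n) =O[atTop] fun n : ℕ => ((n : ℝ) ^ M)⁻¹ := by
    intro x hx
    refine exists_tendsto_of_diff_isBigO ?_
    simp only [rightTerm_succ]
    refine IsBigO.add ?_ ((hp.2 1 (by simpa using hnat 1)).sub (hp.2 (x + 1) (hdom x hx)))
    -- At `n + 1 + k`, `p (n + 1)` is used with offset `k` and `p n` with offset `k + 1`.
    refine polySum_isBigO (N := N) (c := fun n => ((n + 1 : ℕ) : ℂ))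
      (fun n => (Polynomial.natDegree_sub_le _ _).trans (max_le (hN _) (hN _))) (fun k => ?_) 1 x
    have h1 := ((hp.2 k (hnat k)).comp_tendsto (tendsto_add_atTop_nat 1)).trans
      (inv_pow_succ_isBigO (M + 2))
    have h2 := hp.2 ((k : ℂ) + 1) (hdom _ (hnat k))
    refine (h2.sub h1).congr_left fun n => ?_
    simp only [Function.comp, Polynomial.eval_sub]
    push_cast
    rw [show (n : ℂ) + (k + 1) = n + 1 + k by ring]
    ring
  choose! g hg1 hg2 using hlim
  have hg0 : g 0 = 0 := by
    refine tendsto_nhds_unique (hg1 0 (by simpa using one_mem_powDomain)) ?_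
    refine tendsto_const_nhds.congr fun n => ?_
    simp [rightTerm, polySum]
  have hrec : ∀ x ∈ powDomain, g x - g (x - 1) = f x := by
    intro x hx
    have h := (hg1 x (powDomain_add_one x hx)).sub (hg1 (x - 1) (by simpa using hx))
    refine tendsto_nhds_unique h ?_
    -- The terms for `x` and `x - 1` differ by exactly `f x` minus the approximation error at `n +
    -- x`.
    have h2 := (hp.tendsto (powDomain_add_one x hx)).const_sub (f x)
    rw [sub_zero] at h2
    refine h2.congr fun n => ?_
    have hs : ∀ n : ℕ, ∑ ν ∈ Finset.Icc 1 n, (f ((ν : ℂ) + (x - 1)) - f ((ν : ℂ) + x)) =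
        f x - f (n + x) := by
      intro n
      induction n with
      | zero => simp
      | succ n ih =>
        rw [Finset.sum_Icc_succ_top (by omega), ih]
        push_cast
        ring_nf
    have h3 := hs n
    rw [Finset.sum_sub_distrib] at h3
    have h4 := sumPoly_add_one (p n) ((n : ℂ) + (x - 1))
    rw [show (n : ℂ) + (x - 1) + 1 = n + x by ring] at h4
    simp only [rightTerm, polySum, Finset.sum_sub_distrib]
    linear_combination -h4 - h3
  have hsum : ∀ x, x + 1 ∈ powDomain → ∀ n : ℕ,
      ∑ ν ∈ Finset.Icc 1 n, f ((ν : ℂ) + x) = g (n + x) - g x := by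
    intro x hx n
    induction n with
    | zero => simp
    | succ n ih =>
      have h := hrec _ (natCast_add_mem_powDomain hx n)
      rw [show (n : ℂ) + (x + 1) - 1 = n + x by ring,
        show (n : ℂ) + (x + 1) = (n + 1 : ℕ) + x by push_cast; ring] at h
      rw [Finset.sum_Icc_succ_top (by omega), ih, ← h]
      ring
  -- The constant makes the polynomial agree with `g` at `n`; its error at `n + x` then equals `g x
  -- - rightTerm f p 1 x n`, already bounded in `hg2`.
  refine ⟨g, ⟨fun n => sumPoly (p n) + Polynomial.C (g n - (sumPoly (p n)).eval (n : ℂ)),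
    ⟨N + 1, fun n => Polynomial.natDegree_add_C.le.trans (sumPoly_natDegree_le (hN n))⟩,
    fun x hx => (hg2 x hx).congr_left fun n => ?_⟩, hrec, hg0⟩
  have h0 := hsum 0 (by simpa using one_mem_powDomain) n
  simp only [add_zero, hg0, sub_zero] at h0
  simp only [rightTerm, polySum, Finset.sum_sub_distrib, add_sub_cancel_right, hsum x hx, h0,
    Polynomial.eval_add, Polynomial.eval_C]
  ring

/-- Each order `M` yields its own antidifference. All of them compute the fractional sum of `f` from
`1`, so uniqueness of that sum makes them agree, and a single `g` inherits every order. -/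
theorem Tame.exists_antidifference {f : ℂ → ℂ} (hf : Tame f) :
    ∃ g : ℂ → ℂ, Tame g ∧ (∀ x ∈ powDomain, g x - g (x - 1) = f x) ∧ g 0 = 0 := by
  have key : ∀ {g : ℂ → ℂ} {M : ℕ} {q}, ApproxOrder g (M + 1) q →
      (∀ x ∈ powDomain, g x - g (x - 1) = f x) → g 0 = 0 →
      ∀ x, x + 1 ∈ powDomain → HasRightSum powDomain f 1 x (g x) := by
    intro g M q hq hg hg0 x hx
    obtain ⟨N, hN⟩ := hq.1
    have h := (FracSum.telescope powDomain_add_one hN (fun x hx => hq.tendsto hx) hg).2 1 x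
      one_mem_powDomain hx
    rwa [sub_self, hg0, sub_zero] at h
  obtain ⟨p, hp⟩ := hf.2 3
  obtain ⟨g, ⟨q, hq⟩, hg, hg0⟩ := hp.exists_antidifference
  obtain ⟨K, hK⟩ := hf.1
  refine ⟨g, ⟨⟨K + 1, fun x hx => isBigO_pow_succ_of_diff ?_⟩, fun M => ?_⟩, hg, hg0⟩
  · refine (hK (x + 1) (powDomain_add_one _ hx)).congr_left fun n => ?_
    rw [← hg _ (natCast_add_mem_powDomain hx n)]
    push_cast
    ring_nf
  -- The construction loses two orders; the extra one makes the errors of `g'` tend to `0` even for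
  -- `M = 0`, as `key` needs.
  · obtain ⟨p', hp'⟩ := hf.2 (M + 1 + 2)
    obtain ⟨g', ⟨q', hq'⟩, hg', hg0'⟩ := hp'.exists_antidifference
    refine ⟨q', hq'.1, fun x hx => ?_⟩
    refine ((hq'.2 x hx).trans (inv_pow_isBigO M.le_succ)).congr_left fun n => ?_
    have hnx : (n : ℂ) + x + 1 ∈ powDomain := by
      rw [add_assoc]
      exact natCast_add_mem_powDomain hx n
    rw [(key hq hg hg0 _ hnx).unique (key hq' hg' hg0' _ hnx)]

/-! ### Power sums and the two summation formulas. -/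

theorem HasRightSum.rightSum_eq {U : Set ℂ} {f : ℂ → ℂ} {a b s : ℂ}
    (h : HasRightSum U f a b s) : rightSum U f a b = s := by
  have h' : ∃ s, HasRightSum U f a b s := ⟨s, h⟩
  rw [rightSum, dif_pos h']
  exact h'.choose_spec.unique h

theorem exists_tame_eq_powSum (a : ℂ) :
    ∃ g : ℂ → ℂ, Tame g ∧ (∀ x ∈ powDomain, g x - g (x - 1) = x ^ a) ∧ g 0 = 0 ∧
      ∀ x, x + 1 ∈ powDomain → powSum a x = g x := by
  obtain ⟨g, hg, hrec, hg0⟩ := (tame_cpow a).exists_antidifference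
  refine ⟨g, hg, hrec, hg0, fun x hx => ?_⟩
  have h := (hg.telescope hrec).2 1 x one_mem_powDomain hx
  rw [sub_self, hg0, sub_zero] at h
  exact h.rightSum_eq

theorem add_one_mem_powDomain {x : ℂ} (hx : ∀ k : ℕ, 1 ≤ k → x ≠ -(k : ℂ)) :
    x + 1 ∈ powDomain := by
  intro k hk
  refine hx (k + 1) (by omega) ?_
  push_cast
  linear_combination hk

/-- Product rule for `A B + D`; `x ^ a * x ^ b = x ^ (a + b)` holds for the principal branch since
`x ≠ 0`. -/
theorem rightSum_powSum_mul_cpow (a b : ℂ) :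
    IsRightSummable powDomain (fun ν => powSum a ν * ν ^ b + powSum b ν * ν ^ a) ∧
      ∀ x, x + 1 ∈ powDomain →
        rightSum powDomain (fun ν => powSum a ν * ν ^ b + powSum b ν * ν ^ a) 1 x =
          powSum a x * powSum b x + powSum (a + b) x := by
  obtain ⟨A, hA, hA1, hA0, hAS⟩ := exists_tame_eq_powSum a
  obtain ⟨B, hB, hB1, hB0, hBS⟩ := exists_tame_eq_powSum b
  obtain ⟨D, hD, hD1, hD0, hDS⟩ := exists_tame_eq_powSum (a + b)
  have h := ((hA.mul hB).add hD).telescope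
    (f := fun ν => powSum a ν * ν ^ b + powSum b ν * ν ^ a) (fun x hx => by
      have hx' := powDomain_add_one x hx
      have hmul := Complex.cpow_add a b (powDomain_ne_zero hx)
      rw [hAS x hx', hBS x hx', ← hA1 x hx, ← hB1 x hx]
      rw [← hA1 x hx, ← hB1 x hx, ← hD1 x hx] at hmul
      linear_combination hmul)
  refine ⟨h.1, fun x hx => ?_⟩
  rw [(h.2 1 x one_mem_powDomain hx).rightSum_eq, hAS x hx, hBS x hx, hDS x hx, sub_self, hA0, hD0]
  ring

/-- The backward difference of `A x * (x + 1)` is `A x + x * x ^ a`, and subtracting `D` removes `x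
^ (a + 1)`. Using `x + 1` directly avoids evaluating `S_0`. -/
theorem rightSum_powSum (a : ℂ) :
    IsRightSummable powDomain (fun ν => powSum a ν) ∧
      ∀ x, x + 1 ∈ powDomain →
        rightSum powDomain (fun ν => powSum a ν) 1 x =
          powSum a x * (x + 1) - powSum (a + 1) x := by
  obtain ⟨A, hA, hA1, hA0, hAS⟩ := exists_tame_eq_powSum a
  obtain ⟨D, hD, hD1, hD0, hDS⟩ := exists_tame_eq_powSum (a + 1)
  have h := ((hA.mul tame_add_one).sub hD).telescope
    (f := fun ν => powSum a ν) (fun x hx => by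
      have hmul := Complex.cpow_add a 1 (powDomain_ne_zero hx)
      rw [Complex.cpow_one, ← hA1 x hx, ← hD1 x hx] at hmul
      rw [hAS x (powDomain_add_one x hx)]
      linear_combination -hmul)
  refine ⟨h.1, fun x hx => ?_⟩
  rw [(h.2 1 x one_mem_powDomain hx).rightSum_eq, hAS x hx, hDS x hx, sub_self, hA0, hD0]
  ring

end FracSum

theorem mainTheorem10 :
    -- all power functions are right summable, so that the sums `S_a(x)` exist
    (∀ a : ℂ, FracSum.IsRightSummable FracSum.powDomain (fun ν => ν ^ a)) ∧
    -- the double sums of powers exist and have the stated values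
    (∀ a b : ℂ,
      FracSum.IsRightSummable FracSum.powDomain
        (fun ν => FracSum.powSum a ν * ν ^ b + FracSum.powSum b ν * ν ^ a) ∧
      ∀ x : ℂ, (∀ k : ℕ, 1 ≤ k → x ≠ -(k : ℂ)) →
        FracSum.rightSum FracSum.powDomain
            (fun ν => FracSum.powSum a ν * ν ^ b + FracSum.powSum b ν * ν ^ a) 1 x =
          FracSum.powSum a x * FracSum.powSum b x + FracSum.powSum (a + b) x) ∧
    -- the special case `b = 0`
    (∀ a : ℂ,
      FracSum.IsRightSummable FracSum.powDomain (fun ν => FracSum.powSum a ν) ∧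
      ∀ x : ℂ, (∀ k : ℕ, 1 ≤ k → x ≠ -(k : ℂ)) →
        FracSum.rightSum FracSum.powDomain (fun ν => FracSum.powSum a ν) 1 x =
          FracSum.powSum a x * (x + 1) - FracSum.powSum (a + 1) x) := by
  refine ⟨fun a => ?_, fun a b => ?_, fun a => ?_⟩
  · obtain ⟨g, hg, hrec, -⟩ := (FracSum.tame_cpow a).exists_antidifference
    exact (hg.telescope hrec).1
  · obtain ⟨h1, h2⟩ := FracSum.rightSum_powSum_mul_cpow a b
    exact ⟨h1, fun x hx => h2 x (FracSum.add_one_mem_powDomain hx)⟩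
  · obtain ⟨h1, h2⟩ := FracSum.rightSum_powSum a
    exact ⟨h1, fun x hx => h2 x (FracSum.add_one_mem_powDomain hx)⟩
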